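/- A directed graph $\Gamma$ consists of a set $\Gamma^0$ of vertices, a set $\Gamma^1$ of edges, and source and range maps $s,r:\Gamma^1\to\Gamma^0$. It is row finite if $s^{-1}(v)$ is finite for every vertex $v$, and connected if any two vertices are joined by a path in which edges may be traversed in either direction. For a field $F$ and a row finite graph $\Gamma$, the Leavitt path algebra $L_F(\Gamma)$ is the (not necessarily unital) associative $F$-algebra generated by the vertices $v$, the edges $e$ and the ghost edges $e^*$ (with $s(v)=r(v)=v$, $s(e^*)=r(e)$ and $r(e^*)=s(e)$), subject to the relations: $s(x)x=x\,r(x)=x$ for every generator $x$; $uv=0$ for distinct vertices $u,v$; $e^*f=0$ for distinct edges $e,f$; $e^*e=r(e)$ for every edge $e$; and $v=\sum_{s(e)=v}ee^*$ for every vertex $v$ that is not a sink. For a field $K$, the Leavitt inverse semigroup $LI(\Gamma)$ is the multiplicative subsemigroup of $L_K(\Gamma)$ generated by all vertices, edges and ghost edges together with $0$. For a semigroup $S$ with zero, $F_0S$ denotes the contracted semigroup algebra, that is, the semigroup algebra $FS$ modulo the ideal spanned by the zero of $S$. **Theorem.** Let $\Gamma$ and $\Delta$ be connected row finite directed graphs,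 let $K$ be a field, and let $LI(\Gamma)$ and $LI(\Delta)$ be constructed over $K$. Let $\varphi: LI(\Gamma)\to LI(\Delta)$ be an isomorphism of semigroups. Then for every field $F$: 1. $L_F(\Gamma)\cong L_F(\Delta)$ as $F$-algebras; 2. $\varphi$ induces an isomorphism of $F$-algebras $\eta: F_0LI(\Gamma)\to F_0LI(\Delta)$, that is, $\eta(x)=\varphi(x)$ for all $x\in LI(\Gamma)$; 3. $\eta(I_\Gamma)=I_\Delta$, where $I_\Gamma$ is the ideal of $F_0LI(\Gamma)$ generated by the elements $\sum_{s(e)=v}ee^*-v$ for all vertices $v\in\Gamma^0$ of out-degree $|s^{-1}(v)|\ge 2$, and $I_\Delta$ is the corresponding ideal of $F_0LI(\Delta)$. -/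

import Mathlib

noncomputable section

/-! ### Ideals and quotients of (not necessarily unital) associative algebras -/

/-- A two-sided ideal of a (not necessarily unital) `F`-algebra `A`: an `F`-subspace closed under
left and right multiplication by all elements of `A`. -/
structure AlgIdeal (F : Type*) (A : Type*) [Field F] [NonUnitalRing A] [Module F A]
    extends Submodule F A where
  mul_mem_left : ∀ (a : A) {x : A}, x ∈ carrier → a * x ∈ carrier
  mul_mem_right : ∀ (a : A) {x : A}, x ∈ carrier → x * a ∈ carrier

namespace AlgIdeal

variable {F : Type*} {A : Type*} [Field F] [NonUnitalRing A] [Module F A]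

variable (F) in
/-- The two-sided ideal of the `F`-algebra `A` generated by the set `S`: the intersection of all
two-sided ideals that contain `S`. -/
def span (S : Set A) : AlgIdeal F A where
  toSubmodule := sInf {N : Submodule F A | ∃ J : AlgIdeal F A, J.toSubmodule = N ∧ S ⊆ (N : Set A)}
  mul_mem_left := by
    intro a x hx
    simp only [AddSubsemigroup.mem_carrier, AddSubmonoid.mem_toSubsemigroup,
      Submodule.mem_toAddSubmonoid, Submodule.mem_sInf] at hx ⊢
    rintro N ⟨J, rfl, hS⟩
    exact J.mul_mem_left a (hx _ ⟨J, rfl, hS⟩)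
  mul_mem_right := by
    intro a x hx
    simp only [AddSubsemigroup.mem_carrier, AddSubmonoid.mem_toSubsemigroup,
      Submodule.mem_toAddSubmonoid, Submodule.mem_sInf] at hx ⊢
    rintro N ⟨J, rfl, hS⟩
    exact J.mul_mem_right a (hx _ ⟨J, rfl, hS⟩)

theorem subset_span (S : Set A) : S ⊆ ((span F S).toSubmodule : Set A) := by
  intro x hx
  simp only [span, SetLike.mem_coe, Submodule.mem_sInf]
  rintro N ⟨J, rfl, hS⟩
  exact hS hx

/-- The quotient algebra `A / I`; as an `F`-vector space it is the quotient of `A` by the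
subspace `I`. -/
def Quotient (I : AlgIdeal F A) : Type _ := A ⧸ I.toSubmodule

variable (I : AlgIdeal F A)

instance : AddCommGroup I.Quotient := inferInstanceAs (AddCommGroup (A ⧸ I.toSubmodule))

instance : Module F I.Quotient := inferInstanceAs (Module F (A ⧸ I.toSubmodule))

/-- The quotient map `A → A / I`. -/
def toQuot : A →ₗ[F] I.Quotient := I.toSubmodule.mkQ

theorem toQuot_surjective : Function.Surjective I.toQuot := I.toSubmodule.mkQ_surjective

theorem toQuot_eq_toQuot {x y : A} : I.toQuot x = I.toQuot y ↔ x - y ∈ I.toSubmodule :=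
  Submodule.Quotient.eq I.toSubmodule

instance : Mul I.Quotient where
  mul := Quotient.map₂ (· * ·) (by
    intro a a' ha b b' hb
    rw [← Quotient.eq_iff_equiv] at ha hb ⊢
    have ha' : a - a' ∈ I.toSubmodule := (Submodule.Quotient.eq I.toSubmodule).1 ha
    have hb' : b - b' ∈ I.toSubmodule := (Submodule.Quotient.eq I.toSubmodule).1 hb
    refine (Submodule.Quotient.eq I.toSubmodule).2 ?_
    have h : a * b - a' * b' = (a - a') * b + a' * (b - b') := by
      rw [sub_mul, mul_sub]; abel
    rw [h]
    exact I.toSubmodule.add_mem (I.mul_mem_right b ha') (I.mul_mem_left a' hb'))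

theorem toQuot_mul (x y : A) : I.toQuot (x * y) = I.toQuot x * I.toQuot y := rfl

instance : NonUnitalRing I.Quotient where
  left_distrib a b c := by
    obtain ⟨a, rfl⟩ := I.toQuot_surjective a
    obtain ⟨b, rfl⟩ := I.toQuot_surjective b
    obtain ⟨c, rfl⟩ := I.toQuot_surjective c
    simp only [← map_add, ← toQuot_mul, mul_add]
  right_distrib a b c := by
    obtain ⟨a, rfl⟩ := I.toQuot_surjective a
    obtain ⟨b, rfl⟩ := I.toQuot_surjective b
    obtain ⟨c, rfl⟩ := I.toQuot_surjective c
    simp only [← map_add, ← toQuot_mul, add_mul]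
  zero_mul a := by
    obtain ⟨a, rfl⟩ := I.toQuot_surjective a
    rw [← map_zero I.toQuot, ← toQuot_mul, zero_mul]
  mul_zero a := by
    obtain ⟨a, rfl⟩ := I.toQuot_surjective a
    rw [← map_zero I.toQuot, ← toQuot_mul, mul_zero]
  mul_assoc a b c := by
    obtain ⟨a, rfl⟩ := I.toQuot_surjective a
    obtain ⟨b, rfl⟩ := I.toQuot_surjective b
    obtain ⟨c, rfl⟩ := I.toQuot_surjective c
    simp only [← toQuot_mul, mul_assoc]

instance [IsScalarTower F A A] : IsScalarTower F I.Quotient I.Quotient where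
  smul_assoc t a b := by
    obtain ⟨a, rfl⟩ := I.toQuot_surjective a
    obtain ⟨b, rfl⟩ := I.toQuot_surjective b
    simp only [smul_eq_mul, ← map_smul, ← toQuot_mul, smul_mul_assoc]

instance [SMulCommClass F A A] : SMulCommClass F I.Quotient I.Quotient where
  smul_comm t a b := by
    obtain ⟨a, rfl⟩ := I.toQuot_surjective a
    obtain ⟨b, rfl⟩ := I.toQuot_surjective b
    simp only [smul_eq_mul, ← map_smul, ← toQuot_mul, mul_smul_comm]

end AlgIdeal

/-! ### Contracted semigroup algebras -/

/-- The contracted semigroup algebra `F₀S` of a semigroup `S` with zero: the semigroup algebra of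
`S` over `F` modulo the ideal generated by (and hence spanned by) the zero element of `S`. -/
abbrev ContractedAlgebra (F : Type*) (S : Type*) [Field F] [SemigroupWithZero S] : Type _ :=
  (AlgIdeal.span F ({MonoidAlgebra.single (0 : S) (1 : F)} : Set (MonoidAlgebra F S))).Quotient

/-- The canonical map `S → F₀S`. -/
def ContractedAlgebra.of (F : Type*) {S : Type*} [Field F] [SemigroupWithZero S] (x : S) :
    ContractedAlgebra F S :=
  AlgIdeal.toQuot _ (MonoidAlgebra.single x (1 : F))

/-! ### Directed graphs -/

/-- A directed graph with vertex set `V` and edge set `E`; loops and multiple edges are allowed. -/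
structure DirectedGraph (V : Type*) (E : Type*) where
  /-- the source map -/
  s : E → V
  /-- the range map -/
  r : E → V

namespace DirectedGraph

variable {V E : Type*}

/-- Every vertex emits only finitely many edges. -/
def RowFinite (Γ : DirectedGraph V E) : Prop := ∀ v, {e | Γ.s e = v}.Finite

/-- Any two vertices are joined by a path in which edges may be traversed in either direction. -/
def Connected (Γ : DirectedGraph V E) : Prop :=
  ∀ v w : V, Relation.ReflTransGen
    (fun a b => ∃ e, (Γ.s e = a ∧ Γ.r e = b) ∨ (Γ.r e = a ∧ Γ.s e = b)) v w

/-- The generators: vertices `v`, edges `e` and ghost edges `e*`. -/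
inductive Gen (V E : Type*)
  | vert (v : V)
  | edge (e : E)
  | ghost (e : E)

/-- The source of a generator: `s(v) = v` and `s(e*) = r(e)`. -/
def src (Γ : DirectedGraph V E) : Gen V E → V
  | .vert v => v
  | .edge e => Γ.s e
  | .ghost e => Γ.r e

/-- The range of a generator: `r(v) = v` and `r(e*) = s(e)`. -/
def rng (Γ : DirectedGraph V E) : Gen V E → V
  | .vert v => v
  | .edge e => Γ.r e
  | .ghost e => Γ.s e

/-! ### Leavitt path algebras -/

/-- The free (non-unital) associative `F`-algebra on vertices, edges and ghost edges: the
semigroup algebra of the free semigroup. -/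
abbrev FreeAlg (F V E : Type*) [Field F] : Type _ := MonoidAlgebra F (FreeSemigroup (Gen V E))

/-- A generator as an element of the free algebra. -/
def FreeAlg.gen (F : Type*) [Field F] (x : Gen V E) : FreeAlg F V E :=
  MonoidAlgebra.single (FreeSemigroup.of x) 1

open FreeAlg Gen in
/-- The defining relations of the Leavitt path algebra: `Relator F Γ a` means that `a = 0` is one
of the defining relations. -/
inductive Relator (F : Type*) [Field F] (Γ : DirectedGraph V E) : FreeAlg F V E → Prop
  | src_mul (x : Gen V E) : Relator F Γ (gen F (vert (Γ.src x)) * gen F x - gen F x)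
  | mul_rng (x : Gen V E) : Relator F Γ (gen F x * gen F (vert (Γ.rng x)) - gen F x)
  | vert_mul_vert (u v : V) (h : u ≠ v) : Relator F Γ (gen F (vert u) * gen F (vert v))
  | ghost_mul_edge_ne (e f : E) (h : e ≠ f) : Relator F Γ (gen F (ghost e) * gen F (edge f))
  | ghost_mul_edge (e : E) :
      Relator F Γ (gen F (ghost e) * gen F (edge e) - gen F (vert (Γ.r e)))
  | cuntz_krieger (v : V) (hfin : {e | Γ.s e = v}.Finite) (hne : {e | Γ.s e = v}.Nonempty) :
      Relator F Γ (gen F (vert v) - ∑ e ∈ hfin.toFinset, gen F (edge e) * gen F (ghost e))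

/-- The Leavitt path algebra `L_F(Γ)`. -/
abbrev LeavittPathAlgebra (F : Type*) [Field F] (Γ : DirectedGraph V E) : Type _ :=
  (AlgIdeal.span F {a | Relator F Γ a}).Quotient

/-- The image of a generator in the Leavitt path algebra. -/
def LeavittPathAlgebra.gen (F : Type*) [Field F] (Γ : DirectedGraph V E) (x : Gen V E) :
    LeavittPathAlgebra F Γ :=
  AlgIdeal.toQuot _ (FreeAlg.gen F x)

/-! ### Leavitt inverse semigroups -/

/-- The Leavitt inverse semigroup `LI(Γ)`: the multiplicative subsemigroup of the Leavitt path
algebra of `Γ` over `K` generated by all vertices, edges and ghost edges together with `0`. -/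
def LeavittInverseSemigroup (K : Type*) [Field K] (Γ : DirectedGraph V E) :
    Subsemigroup (LeavittPathAlgebra K Γ) :=
  Subsemigroup.closure ({0} ∪ Set.range (LeavittPathAlgebra.gen K Γ))

instance (K : Type*) [Field K] (Γ : DirectedGraph V E) :
    SemigroupWithZero (LeavittInverseSemigroup K Γ) where
  zero := ⟨0, Subsemigroup.subset_closure (Or.inl rfl)⟩
  zero_mul a := Subtype.ext (zero_mul (a : LeavittPathAlgebra K Γ))
  mul_zero a := Subtype.ext (mul_zero (a : LeavittPathAlgebra K Γ))

/-- A generator as an element of `LI(Γ)`. -/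
def LeavittInverseSemigroup.gen (K : Type*) [Field K] (Γ : DirectedGraph V E) (x : Gen V E) :
    LeavittInverseSemigroup K Γ :=
  ⟨LeavittPathAlgebra.gen K Γ x, Subsemigroup.subset_closure (Or.inr ⟨x, rfl⟩)⟩

open LeavittInverseSemigroup ContractedAlgebra in
/-- The ideal of Cuntz–Krieger relations in `F₀LI(Γ)`: the ideal generated by the elements
`∑_{s(e) = v} e e* - v`, for the vertices `v` of (finite) out-degree at least `2`. -/
def cuntzKriegerIdeal (F K : Type*) [Field F] [Field K] (Γ : DirectedGraph V E) :
    AlgIdeal F (ContractedAlgebra F (LeavittInverseSemigroup K Γ)) :=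
  AlgIdeal.span F {a | ∃ (v : V) (hfin : {e | Γ.s e = v}.Finite), 2 ≤ hfin.toFinset.card ∧
    a = ∑ e ∈ hfin.toFinset, of F (gen K Γ (.edge e) * gen K Γ (.ghost e))
      - of F (gen K Γ (.vert v))}

end DirectedGraph

end

/-!
Write `LI` for the Leavitt inverse semigroup. Its construction refers to a field, but it is already
determined by the graph: it is universal among semigroups with zero containing elements `v`, `e`,
`e*` that satisfy the relations of the Leavitt path algebra, where the Cuntz–Krieger relation is
kept only at the vertices of out-degree one, in the multiplicative form `v = e e*`
(`LeavittInverseSemigroup.exists_hom`). Indeed these relations bring every product of generators to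
the form `0` or `l m*`, for paths `l` and `m` with the same end. The Leavitt path algebra is graded
by `ℤ` with nonzero vertices, as one sees from its action on functions of a boundary path and an
integer. Given this grading, `l m* = l' m'*` forces the two pairs of paths to differ by a common
path `u` along which all vertices have out-degree one (`IsFamily.nf_eq_nf`), and then the equality
follows from the relations. In particular `LI`, constructed over `K`, maps to the Leavitt path
algebra over any field `F`.

It remains to see that the Cuntz–Krieger relations are visible in the semigroup. Call idempotents
`a i` below an idempotent `b` an orthogonal cover of `b` if they are pairwise orthogonal and every
nonzero idempotent below `b` has nonzero product with one of them; isomorphisms preserve this. For a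
vertex `v` that is not a sink, the `e e*` with `s(e) = v` form an orthogonal cover of `v`.
Conversely, for every finite orthogonal cover the difference `∑ a i - b` lies in the
Cuntz–Krieger ideal (`IsOrthogonalCover.sum_sub_mem`): nonzero idempotents of `LI` have the form
`l l*`, modulo the ideal `b` is the sum of the `t t*` over the extensions `t` of its path that have
a given large length or end in a sink, and each of these `t t*` lies below exactly one `a i`. Hence
an isomorphism `φ` carries the Cuntz–Krieger ideal into the Cuntz–Krieger ideal, and so does its
inverse, and `x ↦ φ x` on generators respects the defining relations of the Leavitt path algebra
over `F`.
-/

noncomputable section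

namespace DirectedGraph

open Gen

variable {V E : Type*} (Γ : DirectedGraph V E)

/-! ### Paths -/

/-- `Γ.IsPath v l w` says that the list of edges `l` is a path from `v` to `w`. -/
def IsPath : V → List E → V → Prop
  | v, [], w => v = w
  | v, e :: l, w => Γ.s e = v ∧ IsPath (Γ.r e) l w

variable {Γ}

theorem IsPath.append {v w u : V} {l m : List E} (hl : Γ.IsPath v l w) (hm : Γ.IsPath w m u) :
    Γ.IsPath v (l ++ m) u := by
  induction l generalizing v with
  | nil => cases hl; exact hm
  | cons e l ih => exact ⟨hl.1, ih hl.2⟩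

/-! ### Families satisfying the relations of the Leavitt inverse semigroup -/

/-- A map `g` from the generators to a semigroup with zero satisfying the multiplicative relations
of the Leavitt path algebra. The Cuntz–Krieger relation is multiplicative only at the vertices of
out-degree one, where it says `v = e e*`. -/
structure IsFamily (Γ : DirectedGraph V E) {S : Type*} [SemigroupWithZero S]
    (g : Gen V E → S) : Prop where
  src_mul (x : Gen V E) : g (vert (Γ.src x)) * g x = g x
  mul_rng (x : Gen V E) : g x * g (vert (Γ.rng x)) = g x
  vert_mul_vert (u v : V) (h : u ≠ v) : g (vert u) * g (vert v) = 0
  ghost_mul_edge_ne (e f : E) (h : e ≠ f) : g (ghost e) * g (edge f) = 0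
  ghost_mul_edge (e : E) : g (ghost e) * g (edge e) = g (vert (Γ.r e))
  vert_eq (e : E) (h : ∀ f, Γ.s f = Γ.s e → f = e) :
    g (vert (Γ.s e)) = g (edge e) * g (ghost e)

section Family

variable {S : Type*} [SemigroupWithZero S] (g : Gen V E → S)

/-- The value in `S` of the path `l` ending at `w`. -/
def pathVal : List E → V → S
  | [], w => g (vert w)
  | e :: l, w => g (edge e) * pathVal l w

/-- The value in `S` of the ghost path `l*`, where the path `l` ends at `w`. -/
def ghostVal : List E → V → S
  | [], w => g (vert w)
  | e :: l, w => ghostVal l w * g (ghost e)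

/-- The value in `S` of `l m*`, where `l` and `m` are paths ending at `w`. -/
def nf (l m : List E) (w : V) : S := pathVal g l w * ghostVal g m w

variable (Γ) in
/-- `x` is zero or of the form `l m*`, for paths `l` and `m` with the same end. -/
def IsNF (x : S) : Prop :=
  x = 0 ∨ ∃ l m v v' w, Γ.IsPath v l w ∧ Γ.IsPath v' m w ∧ x = nf g l m w

theorem map_pathVal {T : Type*} [SemigroupWithZero T] (f : S →ₙ* T) (l : List E) (w : V) :
    f (pathVal g l w) = pathVal (fun x => f (g x)) l w := by
  induction l with
  | nil => rfl
  | cons e l ih => simp only [pathVal, map_mul, ih]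

theorem map_ghostVal {T : Type*} [SemigroupWithZero T] (f : S →ₙ* T) (l : List E) (w : V) :
    f (ghostVal g l w) = ghostVal (fun x => f (g x)) l w := by
  induction l with
  | nil => rfl
  | cons e l ih => simp only [ghostVal, map_mul, ih]

theorem map_nf {T : Type*} [SemigroupWithZero T] (f : S →ₙ* T) (l m : List E) (w : V) :
    f (nf g l m w) = nf (fun x => f (g x)) l m w := by
  simp only [nf, map_mul, map_pathVal, map_ghostVal]

variable {g}

namespace IsFamily

theorem vert_mul_self (hg : Γ.IsFamily g) (v : V) : g (vert v) * g (vert v) = g (vert v) :=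
  hg.src_mul (vert v)

theorem vert_mul_pathVal (hg : Γ.IsFamily g) {v w : V} {l : List E} (hl : Γ.IsPath v l w) :
    g (vert v) * pathVal g l w = pathVal g l w := by
  cases l with
  | nil => cases hl; exact hg.vert_mul_self v
  | cons e l => rw [pathVal, ← mul_assoc, ← hl.1]; exact congrArg (· * _) (hg.src_mul (edge e))

theorem vert_mul_pathVal_ne (hg : Γ.IsFamily g) {u v w : V} {l : List E} (hl : Γ.IsPath v l w)
    (h : u ≠ v) : g (vert u) * pathVal g l w = 0 := by
  rw [← hg.vert_mul_pathVal hl, ← mul_assoc, hg.vert_mul_vert _ _ h, zero_mul]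

theorem pathVal_mul_vert (hg : Γ.IsFamily g) (l : List E) (w : V) :
    pathVal g l w * g (vert w) = pathVal g l w := by
  induction l with
  | nil => exact hg.vert_mul_self w
  | cons e l ih => rw [pathVal, mul_assoc, ih]

theorem vert_mul_ghostVal (hg : Γ.IsFamily g) (l : List E) (w : V) :
    g (vert w) * ghostVal g l w = ghostVal g l w := by
  induction l with
  | nil => exact hg.vert_mul_self w
  | cons e l ih => rw [ghostVal, ← mul_assoc, ih]

theorem ghostVal_mul_vert (hg : Γ.IsFamily g) {v w : V} {l : List E} (hl : Γ.IsPath v l w) :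
    ghostVal g l w * g (vert v) = ghostVal g l w := by
  cases l with
  | nil => cases hl; exact hg.vert_mul_self v
  | cons e l => rw [ghostVal, mul_assoc, ← hl.1]; exact congrArg (_ * ·) (hg.mul_rng (ghost e))

theorem pathVal_append (hg : Γ.IsFamily g) {v w : V} (l : List E) {m : List E}
    (hm : Γ.IsPath v m w) : pathVal g (l ++ m) w = pathVal g l v * pathVal g m w := by
  induction l with
  | nil => exact (hg.vert_mul_pathVal hm).symm
  | cons e l ih => rw [List.cons_append, pathVal, pathVal, ih, mul_assoc]

theorem ghostVal_append (hg : Γ.IsFamily g) {v w : V} (l : List E) {m : List E}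
    (hm : Γ.IsPath v m w) : ghostVal g (l ++ m) w = ghostVal g m w * ghostVal g l v := by
  induction l with
  | nil => exact (hg.ghostVal_mul_vert hm).symm
  | cons e l ih => rw [List.cons_append, ghostVal, ghostVal, ih, mul_assoc]

theorem pathVal_singleton (hg : Γ.IsFamily g) (e : E) : pathVal g [e] (Γ.r e) = g (edge e) :=
  hg.mul_rng (edge e)

theorem ghostVal_singleton (hg : Γ.IsFamily g) (e : E) : ghostVal g [e] (Γ.r e) = g (ghost e) :=
  hg.src_mul (ghost e)

theorem ghostVal_mul_pathVal_self (hg : Γ.IsFamily g) {v w : V} {l : List E}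
    (hl : Γ.IsPath v l w) : ghostVal g l w * pathVal g l w = g (vert w) := by
  induction l generalizing v with
  | nil => exact hg.vert_mul_self w
  | cons e l ih =>
    rw [ghostVal, pathVal, mul_assoc, ← mul_assoc (g (ghost e)), hg.ghost_mul_edge,
      hg.vert_mul_pathVal hl.2, ih hl.2]

/-- The product `l* l'` vanishes unless one of the two paths is a prefix of the other. -/
theorem ghostVal_mul_pathVal (hg : Γ.IsFamily g) {v w v' w' : V} {l l' : List E}
    (hl : Γ.IsPath v l w) (hl' : Γ.IsPath v' l' w') :
    ghostVal g l w * pathVal g l' w' = 0 ∨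
    (∃ u, l' = l ++ u ∧ Γ.IsPath w u w' ∧ ghostVal g l w * pathVal g l' w' = pathVal g u w') ∨
    (∃ u, l = l' ++ u ∧ Γ.IsPath w' u w ∧ ghostVal g l w * pathVal g l' w' = ghostVal g u w) := by
  induction l generalizing v v' l' with
  | nil =>
    cases hl
    by_cases h : w = v'
    · subst h
      exact .inr (.inl ⟨l', rfl, hl', hg.vert_mul_pathVal hl'⟩)
    · exact .inl (hg.vert_mul_pathVal_ne hl' h)
  | cons e l ih =>
    cases l' with
    | nil =>
      cases hl'
      by_cases h : v = w'
      · subst h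
        exact .inr (.inr ⟨e :: l, rfl, hl, hg.ghostVal_mul_vert hl⟩)
      · left
        rw [← hg.ghostVal_mul_vert hl, mul_assoc, pathVal, hg.vert_mul_vert _ _ h, mul_zero]
    | cons f l' =>
      by_cases h : e = f
      · subst h
        have key : ghostVal g (e :: l) w * pathVal g (e :: l') w' =
            ghostVal g l w * pathVal g l' w' := by
          rw [ghostVal, pathVal, mul_assoc, ← mul_assoc (g (ghost e)), hg.ghost_mul_edge,
            hg.vert_mul_pathVal hl'.2]
        rw [key]
        rcases ih hl.2 hl'.2 with h | ⟨u, rfl, hu, h⟩ | ⟨u, rfl, hu, h⟩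
        · exact .inl h
        · exact .inr (.inl ⟨u, rfl, hu, h⟩)
        · exact .inr (.inr ⟨u, rfl, hu, h⟩)
      · left
        rw [ghostVal, pathVal, mul_assoc, ← mul_assoc (g (ghost e)), hg.ghost_mul_edge_ne e f h,
          zero_mul, mul_zero]

theorem isNF_gen (hg : Γ.IsFamily g) (x : Gen V E) : Γ.IsNF g (g x) := by
  right
  cases x with
  | vert v => exact ⟨[], [], v, v, v, rfl, rfl, (hg.vert_mul_self v).symm⟩
  | edge e =>
    refine ⟨[e], [], Γ.s e, Γ.r e, Γ.r e, ⟨rfl, rfl⟩, rfl, ?_⟩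
    rw [nf, hg.pathVal_singleton]
    exact (hg.mul_rng (edge e)).symm
  | ghost e =>
    refine ⟨[], [e], Γ.r e, Γ.s e, Γ.r e, rfl, ⟨rfl, rfl⟩, ?_⟩
    rw [nf, hg.ghostVal_singleton]
    exact (hg.src_mul (ghost e)).symm

/-- Normal forms are stable under left multiplication by generators. -/
theorem isNF_gen_mul (hg : Γ.IsFamily g) (x : Gen V E) {y : S} (hy : Γ.IsNF g y) :
    Γ.IsNF g (g x * y) := by
  obtain rfl | ⟨l, m, v, v', w, hl, hm, rfl⟩ := hy
  · exact .inl (mul_zero _)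
  by_cases h : Γ.rng x = v
  swap
  · left
    rw [nf, ← hg.vert_mul_pathVal hl, ← hg.mul_rng x, mul_assoc, ← mul_assoc (g (vert _)),
      ← mul_assoc (g (vert _)), hg.vert_mul_vert _ _ h, zero_mul, zero_mul, mul_zero]
  subst h
  cases x with
  | vert u => exact .inr ⟨l, m, u, v', w, hl, hm, by
      rw [nf, ← mul_assoc]; exact congrArg (· * _) (hg.vert_mul_pathVal hl)⟩
  | edge e => exact .inr ⟨e :: l, m, Γ.s e, v', w, ⟨rfl, hl⟩, hm, by
      rw [nf, nf, pathVal, mul_assoc]⟩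
  | ghost e =>
    cases l with
    | nil =>
      cases hl
      refine .inr ⟨[], m ++ [e], Γ.r e, v', Γ.r e, rfl, hm.append ⟨rfl, rfl⟩, ?_⟩
      rw [nf, nf, hg.ghostVal_append m (v := Γ.s e) (m := [e]) (w := Γ.r e) ⟨rfl, rfl⟩,
        hg.ghostVal_singleton]
      simp only [pathVal]
      rw [← mul_assoc, ← mul_assoc]
      exact congrArg (· * _) ((hg.mul_rng (ghost e)).trans (hg.src_mul (ghost e)).symm)
    | cons f l =>
      by_cases h : e = f
      · subst h
        refine .inr ⟨l, m, Γ.r e, v', w, hl.2, hm, ?_⟩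
        rw [nf, nf, pathVal, ← mul_assoc, ← mul_assoc, hg.ghost_mul_edge,
          hg.vert_mul_pathVal hl.2]
      · left
        rw [nf, pathVal, ← mul_assoc, ← mul_assoc, hg.ghost_mul_edge_ne e f h, zero_mul, zero_mul]

/-- Every element of the semigroup generated by a family is zero or of the form `l m*`. -/
theorem isNF_of_mem_closure (hg : Γ.IsFamily g) {x : S}
    (hx : x ∈ Subsemigroup.closure ({0} ∪ Set.range g)) : Γ.IsNF g x := by
  have hmul : ∀ x ∈ Subsemigroup.closure ({0} ∪ Set.range g), ∀ y, Γ.IsNF g y →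
      Γ.IsNF g (x * y) := by
    intro x hx
    induction hx using Subsemigroup.closure_induction with
    | mem x hx =>
      obtain rfl | ⟨x, rfl⟩ := hx
      · exact fun y _ => .inl (zero_mul y)
      · exact fun y hy => hg.isNF_gen_mul x hy
    | mul x y _ _ hx hy => exact fun z hz => mul_assoc x y z ▸ hx _ (hy _ hz)
  induction hx using Subsemigroup.closure_induction with
  | mem x hx =>
    obtain rfl | ⟨x, rfl⟩ := hx
    · exact .inl rfl
    · exact hg.isNF_gen x
  | mul x y hx _ _ hy => exact hmul x hx y hy

end IsFamily

variable (g) in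
theorem pathVal_mem_closure (l : List E)
    (w : V) : pathVal g l w ∈ Subsemigroup.closure ({0} ∪ Set.range g) := by
  induction l with
  | nil => exact Subsemigroup.subset_closure (.inr ⟨_, rfl⟩)
  | cons e l ih => exact Subsemigroup.mul_mem _ (Subsemigroup.subset_closure (.inr ⟨_, rfl⟩)) ih

variable (g) in
theorem ghostVal_mem_closure (l : List E)
    (w : V) : ghostVal g l w ∈ Subsemigroup.closure ({0} ∪ Set.range g) := by
  induction l with
  | nil => exact Subsemigroup.subset_closure (.inr ⟨_, rfl⟩)
  | cons e l ih => exact Subsemigroup.mul_mem _ ih (Subsemigroup.subset_closure (.inr ⟨_, rfl⟩))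

theorem IsNF.mem_closure {x : S}
    (hx : Γ.IsNF g x) : x ∈ Subsemigroup.closure ({0} ∪ Set.range g) := by
  obtain rfl | ⟨l, m, -, -, w, -, -, rfl⟩ := hx
  · exact Subsemigroup.subset_closure (.inl rfl)
  · exact Subsemigroup.mul_mem _ (pathVal_mem_closure g l w) (ghostVal_mem_closure g m w)

/-! ### Gradings and uniqueness of normal forms -/

variable (g) in
/-- A `ℤ`-grading of the values of `g`, recorded as a predicate `D d x` ("`x` is homogeneous of
degree `d`"): edges have degree `1`, ghost edges degree `-1`, zero has every degree and vertices
only the degree `0`. In particular the existence of a grading implies that vertices are nonzero. -/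
structure IsGrading (D : ℤ → S → Prop) : Prop where
  zero_mem (d : ℤ) : D d 0
  vert_mem (v : V) : D 0 (g (vert v))
  edge_mem (e : E) : D 1 (g (edge e))
  ghost_mem (e : E) : D (-1) (g (ghost e))
  mul_mem {c d : ℤ} {x y : S} : D c x → D d y → D (c + d) (x * y)
  eq_zero {d : ℤ} {v : V} : D d (g (vert v)) → d = 0

namespace IsGrading

variable {D : ℤ → S → Prop}

theorem vert_ne_zero (hD : IsGrading g D) (v : V) : g (vert v) ≠ 0 := fun h =>
  one_ne_zero (hD.eq_zero (v := v) (h ▸ hD.zero_mem 1))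

theorem pathVal_mem (hD : IsGrading g D) (l : List E) (w : V) : D l.length (pathVal g l w) := by
  induction l with
  | nil => exact hD.vert_mem w
  | cons e l ih =>
    have := hD.mul_mem (hD.edge_mem e) ih
    rw [add_comm] at this
    simpa [pathVal] using this

theorem ghostVal_mem (hD : IsGrading g D) (l : List E) (w : V) :
    D (-l.length) (ghostVal g l w) := by
  induction l with
  | nil => simpa [ghostVal] using hD.vert_mem w
  | cons e l ih =>
    have := hD.mul_mem ih (hD.ghost_mem e)
    rw [← neg_add] at this
    simpa [ghostVal] using this

theorem nf_mem (hD : IsGrading g D) (l m : List E) (w : V) :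
    D (l.length - m.length) (nf g l m w) := by
  simpa [sub_eq_add_neg, nf] using hD.mul_mem (hD.pathVal_mem l w) (hD.ghostVal_mem m w)

end IsGrading

namespace IsFamily

variable {D : ℤ → S → Prop}

/-- Two-sided cancellation: `l* (l m*) m` is the common end vertex of `l` and `m`. -/
theorem ghostVal_mul_nf_mul_pathVal (hg : Γ.IsFamily g) {v v' w : V} {l m : List E}
    (hl : Γ.IsPath v l w) (hm : Γ.IsPath v' m w) :
    ghostVal g l w * nf g l m w * pathVal g m w = g (vert w) := by
  rw [nf, mul_assoc, mul_assoc, hg.ghostVal_mul_pathVal_self hm, ← mul_assoc,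
    hg.ghostVal_mul_pathVal_self hl, hg.vert_mul_self]

theorem nf_ne_zero (hg : Γ.IsFamily g) (hD : IsGrading g D) {v v' w : V} {l m : List E}
    (hl : Γ.IsPath v l w) (hm : Γ.IsPath v' m w) : nf g l m w ≠ 0 := fun h =>
  hD.vert_ne_zero w <| by
    rw [← hg.ghostVal_mul_nf_mul_pathVal hl hm, h, mul_zero, zero_mul]

theorem eq_of_ghostVal_mul_pathVal_ne_zero (hg : Γ.IsFamily g) {v w v' w' : V} {l l' : List E}
    (hl : Γ.IsPath v l w) (hl' : Γ.IsPath v' l' w') (hlen : l.length = l'.length)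
    (h : ghostVal g l w * pathVal g l' w' ≠ 0) : l = l' := by
  rcases hg.ghostVal_mul_pathVal hl hl' with h0 | ⟨u, rfl, -, -⟩ | ⟨u, rfl, -, -⟩
  · exact absurd h0 h
  · rw [List.eq_nil_of_length_eq_zero (l := u) (by simpa using hlen), List.append_nil]
  · rw [List.eq_nil_of_length_eq_zero (l := u) (by simpa using hlen), List.append_nil]

/-- If `u u*` is a vertex, then every edge of `u` is the only edge emitted by its source. -/
theorem forced_of_nf_eq_vert (hg : Γ.IsFamily g) (hD : IsGrading g D) {w w' : V} {u : List E}
    (hu : Γ.IsPath w u w') (h : nf g u u w' = g (vert w)) :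
    ∀ e ∈ u, ∀ f, Γ.s f = Γ.s e → f = e := by
  induction u generalizing w with
  | nil => simp
  | cons e u ih =>
    obtain ⟨rfl, hu⟩ := hu
    have h' : g (vert (Γ.s e)) = g (edge e) * (nf g u u w' * g (ghost e)) := by
      rw [← h]; simp only [nf, DirectedGraph.pathVal, DirectedGraph.ghostVal, mul_assoc]
    rintro f (_ | ⟨_, hf⟩)
    · intro f hf
      by_contra hne
      apply hD.vert_ne_zero (Γ.r f)
      have : g (ghost f) * g (vert (Γ.s e)) = g (ghost f) := hf ▸ hg.mul_rng (ghost f)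
      rw [← hg.ghost_mul_edge, ← this, h', ← mul_assoc, hg.ghost_mul_edge_ne f e hne, zero_mul,
        zero_mul]
    · refine ih hu ?_ f hf
      have h1 : nf g u u w' = g (ghost e) * g (vert (Γ.s e)) * g (edge e) := by
        rw [h', ← mul_assoc, hg.ghost_mul_edge, mul_assoc, mul_assoc, hg.ghost_mul_edge, nf,
          mul_assoc, hg.ghostVal_mul_vert hu, ← mul_assoc, hg.vert_mul_pathVal hu]
      rw [h1, ← hg.ghost_mul_edge]
      exact congrArg (· * _) (hg.mul_rng (ghost e))

theorem vert_eq_nf (hg : Γ.IsFamily g) {w w' : V} {u : List E} (hu : Γ.IsPath w u w')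
    (h : ∀ e ∈ u, ∀ f, Γ.s f = Γ.s e → f = e) : g (vert w) = nf g u u w' := by
  induction u generalizing w with
  | nil => cases hu; exact (hg.vert_mul_self _).symm
  | cons e u ih =>
    obtain ⟨rfl, hu⟩ := hu
    have h2 : nf g (e :: u) (e :: u) w' = g (edge e) * (nf g u u w' * g (ghost e)) := by
      simp only [nf, DirectedGraph.pathVal, DirectedGraph.ghostVal, mul_assoc]
    rw [h2, ← ih hu fun f hf => h f (List.mem_cons_of_mem _ hf), hg.vert_eq e (h e (by simp))]
    exact congrArg (_ * ·) (hg.src_mul (ghost e)).symm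

/-- Common continuations along vertices of out-degree one cancel. -/
theorem nf_append (hg : Γ.IsFamily g) {w w' : V} (l m : List E) {u : List E}
    (hu : Γ.IsPath w u w') (h : ∀ e ∈ u, ∀ f, Γ.s f = Γ.s e → f = e) :
    nf g (l ++ u) (m ++ u) w' = nf g l m w := by
  rw [nf, hg.pathVal_append l hu, hg.ghostVal_append m hu, mul_assoc, ← mul_assoc (pathVal g u w'),
    ← nf, ← hg.vert_eq_nf hu h, hg.vert_mul_ghostVal, nf]

end IsFamily

/-- Coincidences between normal forms in a graded family occur in every family: if `l m* = l' m'*`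
then the two sides differ by a path `u` all of whose edges are the only ones emitted by their
source, so that `u u*` is a vertex already by the defining relations. -/
theorem IsFamily.nf_eq_nf (hg : Γ.IsFamily g) {D : ℤ → S → Prop} (hD : IsGrading g D)
    {T : Type*} [SemigroupWithZero T] {k : Gen V E → T} (hk : Γ.IsFamily k)
    {a b w a' b' w' : V} {l m l' m' : List E}
    (hl : Γ.IsPath a l w) (hm : Γ.IsPath b m w) (hl' : Γ.IsPath a' l' w')
    (hm' : Γ.IsPath b' m' w') (h : nf g l m w = nf g l' m' w') :
    nf k l m w = nf k l' m' w' := by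
  wlog hlen : l.length ≤ l'.length generalizing a b w a' b' w' l m l' m'
  · exact (this hl' hm' hl hm h.symm (by omega)).symm
  have h1 : g (vert w) =
      (ghostVal g l w * pathVal g l' w') * (ghostVal g m' w' * pathVal g m w) := by
    rw [← hg.ghostVal_mul_nf_mul_pathVal hl hm, h, nf]; simp only [mul_assoc]
  have hu0 : ghostVal g l w * pathVal g l' w' ≠ 0 := fun h0 =>
    hD.vert_ne_zero w (by rw [h1, h0, zero_mul])
  have ht0 : ghostVal g m' w' * pathVal g m w ≠ 0 := fun h0 =>
    hD.vert_ne_zero w (by rw [h1, h0, mul_zero])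
  obtain ⟨u, rfl, hu, hu1⟩ : ∃ u, l' = l ++ u ∧ Γ.IsPath w u w' ∧
      ghostVal g l w * pathVal g l' w' = pathVal g u w' := by
    rcases hg.ghostVal_mul_pathVal hl hl' with h0 | hu | ⟨u, rfl, hu, hu1⟩
    · exact absurd h0 hu0
    · exact hu
    · obtain rfl : u = [] := List.eq_nil_of_length_eq_zero (by simp at hlen; simp [hlen])
      cases hu
      exact ⟨[], by simp, rfl, hu1⟩
  -- The identity `h1` now reads `w = u (m'* m)`; it remains to compare `m` and `m'`.
  rw [hu1] at h1
  rcases hg.ghostVal_mul_pathVal hm' hm with h0 | ⟨t, rfl, ht, ht1⟩ | ⟨t, rfl, ht, ht1⟩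
  · exact absurd h0 ht0
  · -- Here `w = u t` for paths `u` and `t`, which must be empty for degree reasons.
    have hd := hD.eq_zero (h1 ▸ ht1 ▸ hD.mul_mem (hD.pathVal_mem u w') (hD.pathVal_mem t w))
    obtain rfl : u = [] := List.eq_nil_of_length_eq_zero (by omega)
    obtain rfl : t = [] := List.eq_nil_of_length_eq_zero (by omega)
    cases hu
    simp
  · -- Here `w = u t*`; multiplication by `t` gives `t = u`, so that `u u*` is a vertex.
    rw [ht1] at h1
    have hd := hD.eq_zero (h1 ▸ hD.mul_mem (hD.pathVal_mem u w') (hD.ghostVal_mem t w'))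
    have h2 : pathVal g t w' = pathVal g u w' := by
      rw [← hg.vert_mul_pathVal ht, h1, mul_assoc, hg.ghostVal_mul_pathVal_self ht,
        hg.pathVal_mul_vert]
    obtain rfl : t = u := hg.eq_of_ghostVal_mul_pathVal_ne_zero ht hu (by omega) (by
      rw [← h2, hg.ghostVal_mul_pathVal_self ht]; exact hD.vert_ne_zero w')
    exact (hk.nf_append l m hu (hg.forced_of_nf_eq_vert hD hu h1.symm)).symm

namespace IsFamily

variable {D : ℤ → S → Prop}

/-- An idempotent `l m*` has `l = m`: it is homogeneous of degree `0`, so `l` and `m` have the same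
length, and they are comparable since `m* l` is nonzero. -/
theorem eq_of_nf_mul_self (hg : Γ.IsFamily g) (hD : IsGrading g D) {v v' w : V} {l m : List E}
    (hl : Γ.IsPath v l w) (hm : Γ.IsPath v' m w) (h : nf g l m w * nf g l m w = nf g l m w) :
    l = m := by
  have h1 : g (vert w) = ghostVal g l w * (nf g l m w * nf g l m w) * pathVal g m w := by
    rw [h, hg.ghostVal_mul_nf_mul_pathVal hl hm]
  have hd := hD.eq_zero (h1 ▸ hD.mul_mem (hD.mul_mem (hD.ghostVal_mem l w)
    (hD.mul_mem (hD.nf_mem l m w) (hD.nf_mem l m w))) (hD.pathVal_mem m w))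
  refine (hg.eq_of_ghostVal_mul_pathVal_ne_zero hm hl (by omega) fun h0 => ?_).symm
  apply hg.nf_ne_zero hD hl hm
  rw [← h, nf, mul_assoc, ← mul_assoc (ghostVal g m w), h0, zero_mul, mul_zero]

theorem nf_self_mul_nf_self (hg : Γ.IsFamily g) {v w w' : V} {l u : List E}
    (hl : Γ.IsPath v l w) (hu : Γ.IsPath w u w') :
    nf g l l w * nf g (l ++ u) (l ++ u) w' = nf g (l ++ u) (l ++ u) w' := by
  rw [nf, nf, hg.pathVal_append l hu, mul_assoc, ← mul_assoc, ← mul_assoc, ← mul_assoc,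
    mul_assoc (pathVal g l w), hg.ghostVal_mul_pathVal_self hl, hg.pathVal_mul_vert]

/-- Idempotents `l l*` and `m m*` with nonzero product come from comparable paths. -/
theorem comparable_of_nf_mul_nf_ne_zero (hg : Γ.IsFamily g) {v w v' w' : V} {l m : List E}
    (hl : Γ.IsPath v l w) (hm : Γ.IsPath v' m w') (h : nf g l l w * nf g m m w' ≠ 0) :
    (∃ u, m = l ++ u ∧ Γ.IsPath w u w') ∨ ∃ u, l = m ++ u ∧ Γ.IsPath w' u w := by
  rcases hg.ghostVal_mul_pathVal hl hm with h0 | ⟨u, hu, hu', -⟩ | ⟨u, hu, hu', -⟩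
  · refine absurd ?_ h
    rw [nf, nf, mul_assoc, ← mul_assoc (ghostVal g l w), h0, zero_mul, mul_zero]
  · exact .inl ⟨u, hu, hu'⟩
  · exact .inr ⟨u, hu, hu'⟩

theorem nf_self_mul_self (hg : Γ.IsFamily g) {v w : V} {l : List E} (hl : Γ.IsPath v l w) :
    nf g l l w * nf g l l w = nf g l l w := by
  simpa using hg.nf_self_mul_nf_self hl (u := []) rfl

end IsFamily
end Family
end DirectedGraph

/-! ### Homomorphisms out of quotients -/

namespace AlgIdeal

variable {F A B : Type*} [Field F] [NonUnitalRing A] [Module F A] [NonUnitalRing B] [Module F B]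

theorem span_le {S : Set A} {J : AlgIdeal F A} (h : S ⊆ (J.toSubmodule : Set A)) :
    (span F S).toSubmodule ≤ J.toSubmodule :=
  sInf_le ⟨J, rfl, h⟩

/-- The preimage of an ideal under a homomorphism of algebras. -/
def comap (f : A →ₙₐ[F] B) (J : AlgIdeal F B) : AlgIdeal F A where
  toSubmodule := J.toSubmodule.comap (f : A →ₗ[F] B)
  mul_mem_left a x hx := by
    change f (a * x) ∈ J.toSubmodule
    rw [map_mul]
    exact J.mul_mem_left _ hx
  mul_mem_right a x hx := by
    change f (x * a) ∈ J.toSubmodule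
    rw [map_mul]
    exact J.mul_mem_right _ hx

theorem mem_comap {f : A →ₙₐ[F] B} {J : AlgIdeal F B} {a : A} :
    a ∈ (comap f J).toSubmodule ↔ f a ∈ J.toSubmodule := Iff.rfl

variable (F B) in
/-- The zero ideal. -/
def bot : AlgIdeal F B where
  toSubmodule := ⊥
  mul_mem_left a x hx := by
    obtain rfl : x = 0 := hx
    simp
  mul_mem_right a x hx := by
    obtain rfl : x = 0 := hx
    simp

/-- A homomorphism that kills `S` factors through the quotient by the ideal generated by `S`. -/
def lift (S : Set A) (f : A →ₙₐ[F] B) (h : ∀ a ∈ S, f a = 0) : (span F S).Quotient →ₙₐ[F] B where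
  toFun := (span F S).toSubmodule.liftQ (f : A →ₗ[F] B)
    (span_le (J := comap f (bot F B)) fun a ha => h a ha)
  map_smul' t a := by
    obtain ⟨a, rfl⟩ := toQuot_surjective _ a
    exact map_smul f t a
  map_zero' := map_zero f
  map_add' a b := by
    obtain ⟨a, rfl⟩ := toQuot_surjective _ a
    obtain ⟨b, rfl⟩ := toQuot_surjective _ b
    exact map_add f a b
  map_mul' a b := by
    obtain ⟨a, rfl⟩ := toQuot_surjective _ a
    obtain ⟨b, rfl⟩ := toQuot_surjective _ b
    exact map_mul f a b

theorem lift_toQuot (S : Set A) (f : A →ₙₐ[F] B) (h : ∀ a ∈ S, f a = 0) (a : A) :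
    lift S f h (toQuot _ a) = f a := rfl

/-- The quotient map as a homomorphism of algebras. -/
def quotHom (J : AlgIdeal F A) : A →ₙₐ[F] J.Quotient where
  toFun := J.toQuot
  map_smul' := map_smul _
  map_zero' := map_zero _
  map_add' := map_add _
  map_mul' := J.toQuot_mul

end AlgIdeal

namespace ContractedAlgebra

variable {F S A : Type*} [Field F] [SemigroupWithZero S] [NonUnitalRing A] [Module F A]

theorem of_mul (x y : S) : of F (x * y) = of F x * of F y := by
  rw [of, of, of, ← AlgIdeal.toQuot_mul, MonoidAlgebra.single_mul_single, one_mul]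

theorem of_zero : of F (0 : S) = 0 := by
  rw [of, ← map_zero (AlgIdeal.toQuot _), AlgIdeal.toQuot_eq_toQuot, sub_zero]
  exact AlgIdeal.subset_span _ rfl

theorem hom_ext {f f' : ContractedAlgebra F S →ₙₐ[F] A} (h : ∀ x, f (of F x) = f' (of F x)) :
    f = f' := by
  have : f.comp (AlgIdeal.quotHom _) = f'.comp (AlgIdeal.quotHom _) :=
    MonoidAlgebra.nonUnitalAlgHom_ext F h
  ext a
  obtain ⟨a, rfl⟩ := AlgIdeal.toQuot_surjective _ a
  exact DFunLike.congr_fun this a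

variable [IsScalarTower F A A] [SMulCommClass F A A]

/-- The universal property of the contracted semigroup algebra. -/
def lift (f : S →ₙ* A) (h : f 0 = 0) : ContractedAlgebra F S →ₙₐ[F] A :=
  AlgIdeal.lift _ (MonoidAlgebra.liftMagma F f) <| by
    rintro _ rfl
    simp [MonoidAlgebra.liftMagma_apply_apply, h]

theorem lift_of (f : S →ₙ* A) (h : f 0 = 0) (x : S) : lift (F := F) f h (of F x) = f x := by
  rw [lift, of, AlgIdeal.lift_toQuot]
  simp [MonoidAlgebra.liftMagma_apply_apply]

end ContractedAlgebra

namespace DirectedGraph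

open Gen

variable {V E : Type*} {Γ : DirectedGraph V E}

namespace LeavittPathAlgebra

variable {F A : Type*} [Field F] [NonUnitalRing A] [Module F A]

theorem toQuot_relator {a : FreeAlg F V E} (h : Relator F Γ a) :
    AlgIdeal.toQuot (AlgIdeal.span F {a | Relator F Γ a}) a = 0 := by
  rw [← map_zero (AlgIdeal.toQuot _), AlgIdeal.toQuot_eq_toQuot, sub_zero]
  exact AlgIdeal.subset_span _ h

variable (F Γ) in
theorem gen_vert_eq_sum (v : V) (hfin : {e | Γ.s e = v}.Finite) (hne : {e | Γ.s e = v}.Nonempty) :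
    gen F Γ (vert v) = ∑ e ∈ hfin.toFinset, gen F Γ (edge e) * gen F Γ (ghost e) := by
  have := toQuot_relator (Relator.cuntz_krieger (F := F) v hfin hne)
  rwa [map_sub, sub_eq_zero, map_sum] at this

variable (F Γ) in
theorem isFamily : Γ.IsFamily (gen F Γ) where
  src_mul x := by
    have := toQuot_relator (Relator.src_mul (F := F) (Γ := Γ) x)
    rwa [map_sub, sub_eq_zero] at this
  mul_rng x := by
    have := toQuot_relator (Relator.mul_rng (F := F) (Γ := Γ) x)
    rwa [map_sub, sub_eq_zero] at this
  vert_mul_vert u v h := toQuot_relator (Relator.vert_mul_vert (F := F) (Γ := Γ) u v h)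
  ghost_mul_edge_ne e f h := toQuot_relator (Relator.ghost_mul_edge_ne (F := F) (Γ := Γ) e f h)
  ghost_mul_edge e := by
    have := toQuot_relator (Relator.ghost_mul_edge (F := F) (Γ := Γ) e)
    rwa [map_sub, sub_eq_zero] at this
  vert_eq e h := by
    have hs : {f | Γ.s f = Γ.s e} = {e} := Set.eq_singleton_iff_unique_mem.2 ⟨rfl, h⟩
    have hfin : {f | Γ.s f = Γ.s e}.Finite := hs ▸ Set.finite_singleton e
    rw [gen_vert_eq_sum Γ F (Γ.s e) hfin ⟨e, rfl⟩, show hfin.toFinset = {e} by ext; simp [hs],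
      Finset.sum_singleton]

variable [IsScalarTower F A A] [SMulCommClass F A A]

/-- The universal property of the Leavitt path algebra. -/
def lift (k : Gen V E → A) (hk : Γ.IsFamily k)
    (hck : ∀ (v : V) (hfin : {e | Γ.s e = v}.Finite), {e | Γ.s e = v}.Nonempty →
      k (vert v) = ∑ e ∈ hfin.toFinset, k (edge e) * k (ghost e)) :
    Γ.LeavittPathAlgebra F →ₙₐ[F] A :=
  AlgIdeal.lift _ (MonoidAlgebra.liftMagma F (FreeSemigroup.lift k)) <| by
    have hgen (x : Gen V E) : MonoidAlgebra.liftMagma F (FreeSemigroup.lift k) (FreeAlg.gen F x)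
        = k x := by
      simp [FreeAlg.gen, MonoidAlgebra.liftMagma_apply_apply]
    rintro _ (x | x | ⟨u, v, h⟩ | ⟨e, f, h⟩ | e | ⟨v, hfin, hne⟩)
    · rw [map_sub, map_mul, hgen, hgen, hk.src_mul, sub_self]
    · rw [map_sub, map_mul, hgen, hgen, hk.mul_rng, sub_self]
    · rw [map_mul, hgen, hgen, hk.vert_mul_vert u v h]
    · rw [map_mul, hgen, hgen, hk.ghost_mul_edge_ne e f h]
    · rw [map_sub, map_mul, hgen, hgen, hgen, hk.ghost_mul_edge, sub_self]
    · rw [map_sub, map_sum, hgen, hck v hfin hne, sub_eq_zero]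
      exact Finset.sum_congr rfl fun e _ => by rw [map_mul, hgen, hgen]

theorem lift_gen (k : Gen V E → A) (hk : Γ.IsFamily k)
    (hck : ∀ (v : V) (hfin : {e | Γ.s e = v}.Finite), {e | Γ.s e = v}.Nonempty →
      k (vert v) = ∑ e ∈ hfin.toFinset, k (edge e) * k (ghost e)) (x : Gen V E) :
    lift (F := F) k hk hck (gen F Γ x) = k x := by
  rw [lift, gen, AlgIdeal.lift_toQuot]
  simp [FreeAlg.gen, MonoidAlgebra.liftMagma_apply_apply]

theorem hom_ext {f f' : Γ.LeavittPathAlgebra F →ₙₐ[F] A}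
    (h : ∀ x, f (gen F Γ x) = f' (gen F Γ x)) : f = f' := by
  have : f.comp (AlgIdeal.quotHom _) = f'.comp (AlgIdeal.quotHom _) := by
    apply (MonoidAlgebra.liftMagma F).symm.injective
    exact FreeSemigroup.hom_ext (funext h)
  ext a
  obtain ⟨a, rfl⟩ := AlgIdeal.toQuot_surjective _ a
  exact DFunLike.congr_fun this a

end LeavittPathAlgebra

/-! ### The boundary path representation -/

/-- The source of a step of a boundary path: an edge, or a stationary step at a vertex. -/
def stepSrc (Γ : DirectedGraph V E) : V ⊕ E → V := Sum.elim id Γ.s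

/-- The range of a step of a boundary path. -/
def stepRng (Γ : DirectedGraph V E) : V ⊕ E → V := Sum.elim id Γ.r

/-- Boundary paths: infinite paths, and finite paths that end in a sink, the latter continued by
stationary steps. -/
def IsBoundary (Γ : DirectedGraph V E) (x : Stream' (V ⊕ E)) : Prop :=
  ∀ n, Γ.stepRng (x.get n) = Γ.stepSrc (x.get (n + 1)) ∧
    ∀ v, x.get n = Sum.inl v → ∀ e, Γ.s e ≠ v

theorem IsBoundary.tail {x : Stream' (V ⊕ E)} (h : Γ.IsBoundary x) : Γ.IsBoundary x.tail :=
  fun n => h (n + 1)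

theorem isBoundary_cons {x : Stream' (V ⊕ E)} {e : E} :
    Γ.IsBoundary (Stream'.cons (Sum.inr e) x) ↔ Γ.r e = Γ.stepSrc x.head ∧ Γ.IsBoundary x := by
  constructor
  · exact fun h => ⟨(h 0).1, h.tail⟩
  · rintro ⟨h, hx⟩ (_ | n)
    · exact ⟨h, fun v hv => by cases hv⟩
    · exact hx n

/-- Every vertex is the start of a boundary path: follow an arbitrary edge as long as there is one,
and stay put at a sink. -/
theorem exists_isBoundary (Γ : DirectedGraph V E) (w : V) :
    ∃ x : Stream' (V ⊕ E), Γ.IsBoundary x ∧ Γ.stepSrc x.head = w := by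
  have hstep (v : V) : ∃ t, Γ.stepSrc t = v ∧ ∀ u, t = Sum.inl u → ∀ e, Γ.s e ≠ u := by
    by_cases h : ∃ e, Γ.s e = v
    · obtain ⟨e, rfl⟩ := h
      exact ⟨Sum.inr e, rfl, fun u hu => by cases hu⟩
    · refine ⟨Sum.inl v, rfl, fun u hu e he => h ⟨e, ?_⟩⟩
      cases hu
      exact he
  choose σ hσ hσ' using hstep
  refine ⟨fun n => σ ((fun v => Γ.stepRng (σ v))^[n] w), fun n => ⟨?_, hσ' _⟩, hσ w⟩
  change _ = Γ.stepSrc (σ _)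
  rw [hσ, Function.iterate_succ_apply']
  rfl

section Operators

open scoped Classical in
/-- The weighted composition operator `f ↦ 1_P · (f ∘ τ)` on functions with values in `K`. -/
def compOp (K : Type*) [Field K] {Z : Type*} (P : Z → Prop) (τ : Z → Z) :
    Module.End K (Z → K) where
  toFun f z := if P z then f (τ z) else 0
  map_add' f f' := by ext z; by_cases h : P z <;> simp [h]
  map_smul' c f := by ext z; by_cases h : P z <;> simp [h]

variable {K : Type*} [Field K] {Z : Type*}

open scoped Classical in
theorem compOp_apply (P : Z → Prop) (τ : Z → Z) (f : Z → K) (z : Z) :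
    compOp K P τ f z = if P z then f (τ z) else 0 := rfl

theorem compOp_mul (P Q : Z → Prop) (τ σ : Z → Z) :
    compOp K P τ * compOp K Q σ = compOp K (fun z => P z ∧ Q (τ z)) (fun z => σ (τ z)) := by
  ext f z
  rw [Module.End.mul_apply]
  by_cases h : P z
  · by_cases h' : Q (τ z)
    · rw [compOp_apply, if_pos h, compOp_apply, if_pos h', compOp_apply, if_pos ⟨h, h'⟩]
    · rw [compOp_apply, if_pos h, compOp_apply, if_neg h', compOp_apply, if_neg fun h => h' h.2]
  · rw [compOp_apply, if_neg h, compOp_apply, if_neg fun h' => h h'.1]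

theorem compOp_congr {P Q : Z → Prop} {τ σ : Z → Z} (h : ∀ z, P z ↔ Q z)
    (h' : ∀ z, P z → τ z = σ z) : compOp K P τ = compOp K Q σ := by
  ext f z
  by_cases hz : P z
  · rw [compOp_apply, if_pos hz, compOp_apply, if_pos ((h z).1 hz), h' z hz]
  · rw [compOp_apply, if_neg hz, compOp_apply, if_neg fun hq => hz ((h z).2 hq)]

theorem compOp_eq_zero {P : Z → Prop} {τ : Z → Z} (h : ∀ z, ¬ P z) : compOp K P τ = 0 := by
  ext f z
  exact if_neg (h z)

/-- The action of the generators on functions of a boundary path and an integer; the integer keeps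
track of the degree. Sequences that are not boundary paths are annihilated. -/
def boundaryOp (K : Type*) [Field K] (Γ : DirectedGraph V E) :
    Gen V E → Module.End K (Stream' (V ⊕ E) × ℤ → K)
  | .vert v => compOp K (fun z => Γ.IsBoundary z.1 ∧ Γ.stepSrc z.1.head = v) id
  | .edge e => compOp K (fun z => Γ.IsBoundary z.1 ∧ z.1.head = Sum.inr e)
      fun z => (z.1.tail, z.2 - 1)
  | .ghost e => compOp K (fun z => Γ.IsBoundary z.1 ∧ Γ.stepSrc z.1.head = Γ.r e)
      fun z => (Stream'.cons (Sum.inr e) z.1, z.2 + 1)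

theorem IsBoundary.stepSrc_tail {x : Stream' (V ⊕ E)} (h : Γ.IsBoundary x) {e : E}
    (he : x.head = Sum.inr e) : Γ.stepSrc x.tail.head = Γ.r e := by
  have := (h 0).1
  rw [show x.get 0 = Sum.inr e from he] at this
  exact this.symm

theorem boundaryOp_edge_mul_ghost (e : E) :
    boundaryOp K Γ (edge e) * boundaryOp K Γ (ghost e) =
      compOp K (fun z => Γ.IsBoundary z.1 ∧ z.1.head = Sum.inr e) id := by
  rw [boundaryOp, boundaryOp, compOp_mul]
  refine compOp_congr (fun z => ⟨fun h => h.1, fun h => ⟨h, h.1.tail, h.1.stepSrc_tail h.2⟩⟩) ?_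
  rintro ⟨x, n⟩ ⟨⟨-, h⟩, -⟩
  change (Stream'.cons (Sum.inr e) x.tail, n - 1 + 1) = (x, n)
  rw [sub_add_cancel, ← show x.head = Sum.inr e from h]
  exact Prod.ext (Stream'.eta x) rfl

theorem boundaryOp_vert_eq_sum (v : V) (hfin : {e | Γ.s e = v}.Finite)
    (hne : {e | Γ.s e = v}.Nonempty) : boundaryOp K Γ (vert v) =
      ∑ e ∈ hfin.toFinset, boundaryOp K Γ (edge e) * boundaryOp K Γ (ghost e) := by
  simp only [boundaryOp_edge_mul_ghost]
  ext f z
  rw [LinearMap.sum_apply, Finset.sum_apply, boundaryOp]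
  by_cases h : Γ.IsBoundary z.1 ∧ Γ.stepSrc z.1.head = v
  · rw [compOp_apply, if_pos h]
    obtain ⟨hb, hv⟩ := h
    cases hx : z.1.head with
    | inl u =>
      obtain ⟨e, he⟩ := hne
      refine absurd ?_ ((hb 0).2 u hx e)
      rw [← show Γ.s e = v from he, hx] at hv
      exact hv.symm
    | inr e =>
      rw [hx] at hv
      rw [Finset.sum_eq_single e, compOp_apply, if_pos ⟨hb, hx⟩]
      · intro e' _ hne
        exact if_neg (fun h => hne (Sum.inr_injective (h.2.symm.trans hx)))
      · exact fun h => absurd (hfin.mem_toFinset.2 hv) h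
  · rw [compOp_apply, if_neg h, Finset.sum_eq_zero]
    intro e he
    refine if_neg (fun h' => h ⟨h'.1, ?_⟩)
    rw [h'.2]
    exact hfin.mem_toFinset.1 he

theorem isFamily_boundaryOp : Γ.IsFamily (boundaryOp K Γ) where
  src_mul x := by
    cases x with
    | vert v =>
      rw [boundaryOp, src, boundaryOp, compOp_mul]
      exact compOp_congr (fun z => ⟨fun h => h.1, fun h => ⟨h, h⟩⟩) fun _ _ => rfl
    | edge e =>
      rw [src, boundaryOp, boundaryOp, compOp_mul]
      exact compOp_congr (fun z => ⟨fun h => h.2, fun h => ⟨⟨h.1, by rw [h.2]; rfl⟩, h⟩⟩)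
        fun _ _ => rfl
    | ghost e =>
      rw [src, boundaryOp, boundaryOp, compOp_mul]
      exact compOp_congr (fun z => ⟨fun h => h.1, fun h => ⟨h, h⟩⟩) fun _ _ => rfl
  mul_rng x := by
    cases x with
    | vert v =>
      rw [boundaryOp, rng, boundaryOp, compOp_mul]
      exact compOp_congr (fun z => ⟨fun h => h.1, fun h => ⟨h, h⟩⟩) fun _ _ => rfl
    | edge e =>
      rw [rng, boundaryOp, boundaryOp, compOp_mul]
      exact compOp_congr (fun z => ⟨fun h => h.1, fun h => ⟨h, h.1.tail, h.1.stepSrc_tail h.2⟩⟩)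
        fun _ _ => rfl
    | ghost e =>
      rw [rng, boundaryOp, boundaryOp, compOp_mul]
      exact compOp_congr (fun z => ⟨fun h => h.1,
        fun h => ⟨h, isBoundary_cons.2 ⟨h.2.symm, h.1⟩, rfl⟩⟩) fun _ _ => rfl
  vert_mul_vert u v h := by
    rw [boundaryOp, boundaryOp, compOp_mul]
    exact compOp_eq_zero fun z hz => h (hz.1.2.symm.trans hz.2.2)
  ghost_mul_edge_ne e f h := by
    rw [boundaryOp, boundaryOp, compOp_mul]
    exact compOp_eq_zero fun z hz => h (Sum.inr_injective hz.2.2)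
  ghost_mul_edge e := by
    rw [boundaryOp, boundaryOp, boundaryOp, compOp_mul]
    refine compOp_congr (fun z => ⟨fun h => h.1,
      fun h => ⟨h, isBoundary_cons.2 ⟨h.2.symm, h.1⟩, rfl⟩⟩) ?_
    rintro ⟨x, n⟩ -
    exact Prod.ext rfl (add_sub_cancel_right n 1)
  vert_eq e h := by
    have hs : {f | Γ.s f = Γ.s e} = {e} := Set.eq_singleton_iff_unique_mem.2 ⟨rfl, h⟩
    have hfin : {f | Γ.s f = Γ.s e}.Finite := hs ▸ Set.finite_singleton e
    rw [boundaryOp_vert_eq_sum (Γ.s e) hfin ⟨e, rfl⟩, show hfin.toFinset = {e} by ext; simp [hs],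
      Finset.sum_singleton]

end Operators

namespace LeavittPathAlgebra

variable (K : Type*) [Field K] (Γ)

/-- The representation of the Leavitt path algebra on functions of a boundary path and an
integer. -/
def boundaryRep : Γ.LeavittPathAlgebra K →ₙₐ[K] Module.End K (Stream' (V ⊕ E) × ℤ → K) :=
  lift (boundaryOp K Γ) isFamily_boundaryOp boundaryOp_vert_eq_sum

/-- The elements whose action at level `n` only sees the values of a function at level `n - d`,
one value at a time. -/
def HasDegree (d : ℤ) (a : Γ.LeavittPathAlgebra K) : Prop :=
  ∀ f x n, boundaryRep Γ K a f (x, n) = 0 ∨ ∃ y, boundaryRep Γ K a f (x, n) = f (y, n - d)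

theorem isGrading : IsGrading (gen K Γ) (HasDegree Γ K) where
  zero_mem d f x n := .inl (by rw [map_zero]; rfl)
  vert_mem v f x n := by
    rw [boundaryRep, lift_gen, boundaryOp]
    by_cases h : Γ.IsBoundary x ∧ Γ.stepSrc x.head = v
    · exact .inr ⟨x, by rw [compOp_apply, if_pos h, sub_zero]; rfl⟩
    · exact .inl (if_neg h)
  edge_mem e f x n := by
    rw [boundaryRep, lift_gen, boundaryOp]
    by_cases h : Γ.IsBoundary x ∧ x.head = Sum.inr e
    · exact .inr ⟨_, if_pos h⟩
    · exact .inl (if_neg h)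
  ghost_mem e f x n := by
    rw [boundaryRep, lift_gen, boundaryOp]
    by_cases h : Γ.IsBoundary x ∧ Γ.stepSrc x.head = Γ.r e
    · exact .inr ⟨_, by rw [sub_neg_eq_add]; exact if_pos h⟩
    · exact .inl (if_neg h)
  mul_mem {c d a b} ha hb f x n := by
    rw [map_mul, Module.End.mul_apply]
    rcases ha (boundaryRep Γ K b f) x n with h | ⟨y, h⟩
    · exact .inl h
    · rw [h, ← sub_sub]
      exact hb f y (n - c)
  eq_zero {d v} h := by
    -- The function supported on level `0` is preserved by `v` at any boundary path from `v`.
    obtain ⟨x, hx, hv⟩ := exists_isBoundary Γ v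
    by_contra hd
    have h1 :
        boundaryRep Γ K (gen K Γ (vert v)) (fun z => if z.2 = 0 then 1 else 0) (x, 0) = 1 := by
      rw [boundaryRep, lift_gen, boundaryOp, compOp_apply, if_pos ⟨hx, hv⟩]
      exact if_pos rfl
    rcases h (fun z => if z.2 = 0 then 1 else 0) x 0 with h0 | ⟨y, h0⟩
    · exact one_ne_zero (h1.symm.trans h0)
    · refine one_ne_zero (α := K) (h1.symm.trans (h0.trans (if_neg ?_)))
      simpa using hd

end LeavittPathAlgebra

/-! ### The structure of the Leavitt inverse semigroup -/

namespace LeavittInverseSemigroup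

variable (K : Type*) [Field K] (Γ)

theorem isFamily : Γ.IsFamily (gen K Γ) where
  src_mul x := Subtype.ext ((LeavittPathAlgebra.isFamily Γ K).src_mul x)
  mul_rng x := Subtype.ext ((LeavittPathAlgebra.isFamily Γ K).mul_rng x)
  vert_mul_vert u v h := Subtype.ext ((LeavittPathAlgebra.isFamily Γ K).vert_mul_vert u v h)
  ghost_mul_edge_ne e f h :=
    Subtype.ext ((LeavittPathAlgebra.isFamily Γ K).ghost_mul_edge_ne e f h)
  ghost_mul_edge e := Subtype.ext ((LeavittPathAlgebra.isFamily Γ K).ghost_mul_edge e)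
  vert_eq e h := Subtype.ext ((LeavittPathAlgebra.isFamily Γ K).vert_eq e h)

theorem isGrading :
    IsGrading (gen K Γ) fun d x => LeavittPathAlgebra.HasDegree Γ K d x.1 where
  zero_mem := (LeavittPathAlgebra.isGrading Γ K).zero_mem
  vert_mem := (LeavittPathAlgebra.isGrading Γ K).vert_mem
  edge_mem := (LeavittPathAlgebra.isGrading Γ K).edge_mem
  ghost_mem := (LeavittPathAlgebra.isGrading Γ K).ghost_mem
  mul_mem := (LeavittPathAlgebra.isGrading Γ K).mul_mem
  eq_zero := (LeavittPathAlgebra.isGrading Γ K).eq_zero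

variable {K Γ}

theorem isNF (x : Γ.LeavittInverseSemigroup K) : Γ.IsNF (gen K Γ) x := by
  obtain h | ⟨l, m, v, v', w, hl, hm, h⟩ :=
    (LeavittPathAlgebra.isFamily Γ K).isNF_of_mem_closure x.2
  · exact .inl (Subtype.ext h)
  · refine .inr ⟨l, m, v, v', w, hl, hm, Subtype.ext (h.trans ?_)⟩
    exact (map_nf (gen K Γ) (MulMemClass.subtype (Γ.LeavittInverseSemigroup K)) l m w).symm

theorem hom_ext {T : Type*} [SemigroupWithZero T] {f f' : Γ.LeavittInverseSemigroup K →ₙ* T}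
    (h0 : f 0 = f' 0) (h : ∀ x, f (gen K Γ x) = f' (gen K Γ x)) : f = f' := by
  ext x
  obtain rfl | ⟨l, m, -, -, w, -, -, rfl⟩ := isNF x
  · exact h0
  · rw [map_nf, map_nf, funext h]

/-- The universal property of the Leavitt inverse semigroup: it maps to every family of elements
satisfying its relations. The graph of the homomorphism is the semigroup generated by the pairs
`(gen x, k x)`; it is the graph of a function by `IsFamily.nf_eq_nf`. -/
theorem exists_hom {T : Type*} [SemigroupWithZero T] {k : Gen V E → T} (hk : Γ.IsFamily k) :
    ∃ f : Γ.LeavittInverseSemigroup K →ₙ* T, f 0 = 0 ∧ ∀ x, f (gen K Γ x) = k x := by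
  have hg := isFamily Γ K
  let p : Gen V E → Γ.LeavittInverseSemigroup K × T := fun x => (gen K Γ x, k x)
  have hp : Γ.IsFamily p :=
    ⟨fun x => Prod.ext (hg.src_mul x) (hk.src_mul x),
      fun x => Prod.ext (hg.mul_rng x) (hk.mul_rng x),
      fun u v h => Prod.ext (hg.vert_mul_vert u v h) (hk.vert_mul_vert u v h),
      fun e f h => Prod.ext (hg.ghost_mul_edge_ne e f h) (hk.ghost_mul_edge_ne e f h),
      fun e => Prod.ext (hg.ghost_mul_edge e) (hk.ghost_mul_edge e),
      fun e h => Prod.ext (hg.vert_eq e h) (hk.vert_eq e h)⟩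
  have hnf (l m : List E) (w : V) : nf p l m w = (nf (gen K Γ) l m w, nf k l m w) :=
    Prod.ext (map_nf p (MulHom.fst _ _) l m w) (map_nf p (MulHom.snd _ _) l m w)
  have huniq {x t t'} (h : Γ.IsNF p (x, t)) (h' : Γ.IsNF p (x, t')) : t = t' := by
    obtain h | ⟨l, m, v, v', w, hl, hm, h⟩ := h
    · obtain ⟨rfl, rfl⟩ := Prod.ext_iff.1 h
      obtain h' | ⟨l', m', a, a', w', hl', hm', h'⟩ := h'
      · exact (Prod.ext_iff.1 h').2.symm
      · rw [hnf] at h'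
        exact absurd (Prod.ext_iff.1 h').1.symm (hg.nf_ne_zero (isGrading Γ K) hl' hm')
    · rw [hnf] at h
      obtain ⟨rfl, rfl⟩ := Prod.ext_iff.1 h
      obtain h' | ⟨l', m', a, a', w', hl', hm', h'⟩ := h'
      · exact absurd (Prod.ext_iff.1 h').1 (hg.nf_ne_zero (isGrading Γ K) hl hm)
      · rw [hnf] at h'
        obtain ⟨h1, rfl⟩ := Prod.ext_iff.1 h'
        exact hg.nf_eq_nf (isGrading Γ K) hk hl hm hl' hm' h1
  have hex (x : Γ.LeavittInverseSemigroup K) : ∃ t, Γ.IsNF p (x, t) := by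
    obtain rfl | ⟨l, m, v, v', w, hl, hm, rfl⟩ := isNF x
    · exact ⟨0, .inl rfl⟩
    · exact ⟨nf k l m w, .inr ⟨l, m, v, v', w, hl, hm, (hnf l m w).symm⟩⟩
  choose f hf using hex
  refine ⟨⟨f, fun x y => huniq (hf _) ?_⟩, huniq (hf 0) (.inl rfl), fun x =>
    huniq (hf _) (hp.isNF_gen x)⟩
  exact hp.isNF_of_mem_closure (Subsemigroup.mul_mem _ (hf x).mem_closure (hf y).mem_closure)

theorem eq_nf_of_mul_self {x : Γ.LeavittInverseSemigroup K} (h : x * x = x) (h0 : x ≠ 0) :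
    ∃ l v w, Γ.IsPath v l w ∧ x = nf (gen K Γ) l l w := by
  obtain h | ⟨l, m, v, v', w, hl, hm, rfl⟩ := isNF x
  · exact absurd h h0
  · obtain rfl := (isFamily Γ K).eq_of_nf_mul_self (isGrading Γ K) hl hm h
    exact ⟨l, v, w, hl, rfl⟩

variable (F : Type*) [Field F]

variable (K Γ) in
/-- The canonical homomorphism from the Leavitt inverse semigroup, constructed over `K`, to the
Leavitt path algebra over another field `F`. -/
def toLeavitt : Γ.LeavittInverseSemigroup K →ₙ* Γ.LeavittPathAlgebra F :=
  (exists_hom (LeavittPathAlgebra.isFamily Γ F)).choose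

theorem toLeavitt_zero : toLeavitt Γ K F 0 = 0 :=
  (exists_hom (LeavittPathAlgebra.isFamily Γ F)).choose_spec.1

theorem toLeavitt_gen (x : Gen V E) :
    toLeavitt Γ K F (gen K Γ x) = LeavittPathAlgebra.gen F Γ x :=
  (exists_hom (LeavittPathAlgebra.isFamily Γ F)).choose_spec.2 x

end LeavittInverseSemigroup

/-! ### Orthogonal covers -/

/-- The idempotents `a i`, for `i ∈ s`, are pairwise orthogonal, lie below the idempotent `b`, and
every nonzero idempotent below `b` has nonzero product with one of them. -/
structure IsOrthogonalCover {S ι : Type*} [SemigroupWithZero S] (s : Finset ι) (a : ι → S)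
    (b : S) : Prop where
  mul_self (i) (hi : i ∈ s) : a i * a i = a i
  base_mul_self : b * b = b
  base_mul (i) (hi : i ∈ s) : b * a i = a i
  mul_base (i) (hi : i ∈ s) : a i * b = a i
  orthogonal (i) (hi : i ∈ s) (j) (hj : j ∈ s) (h : i ≠ j) : a i * a j = 0
  exists_mul_ne_zero (c : S) (hc : c * c = c) (hb : b * c = c) (h0 : c ≠ 0) :
    ∃ i ∈ s, a i * c ≠ 0

theorem IsOrthogonalCover.map {S T ι : Type*} [SemigroupWithZero S] [SemigroupWithZero T]
    {s : Finset ι} {a : ι → S} {b : S} (h : IsOrthogonalCover s a b) (φ : S ≃* T) :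
    IsOrthogonalCover s (fun i => φ (a i)) (φ b) where
  mul_self i hi := by rw [← map_mul, h.mul_self i hi]
  base_mul_self := by rw [← map_mul, h.base_mul_self]
  base_mul i hi := by rw [← map_mul, h.base_mul i hi]
  mul_base i hi := by rw [← map_mul, h.mul_base i hi]
  orthogonal i hi j hj hij := by rw [← map_mul, h.orthogonal i hi j hj hij, map_zero]
  exists_mul_ne_zero c hc hb h0 := by
    obtain ⟨c, rfl⟩ := φ.surjective c
    rw [← map_mul, φ.apply_eq_iff_eq] at hc hb
    obtain ⟨i, hi, hne⟩ := h.exists_mul_ne_zero c hc hb fun h => h0 (by rw [h, map_zero])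
    exact ⟨i, hi, by rwa [← map_mul, Ne, map_eq_zero_iff φ φ.injective]⟩

namespace LeavittInverseSemigroup

variable {K : Type*} [Field K]

theorem isOrthogonalCover_edges (v : V) (hfin : {e | Γ.s e = v}.Finite)
    (hne : {e | Γ.s e = v}.Nonempty) :
    IsOrthogonalCover hfin.toFinset (fun e => gen K Γ (edge e) * gen K Γ (ghost e))
      (gen K Γ (vert v)) := by
  have hg := isFamily Γ K
  have hmul (e : E) : gen K Γ (edge e) * gen K Γ (ghost e) * gen K Γ (edge e) =
      gen K Γ (edge e) := by
    rw [mul_assoc, hg.ghost_mul_edge]; exact hg.mul_rng (edge e)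
  refine ⟨fun e _ => ?_, hg.vert_mul_self v, fun e he => ?_, fun e he => ?_,
    fun e _ f _ hef => ?_, fun c hc hb h0 => ?_⟩
  · rw [← mul_assoc, hmul]
  · obtain rfl := hfin.mem_toFinset.1 he
    rw [← mul_assoc]; exact congrArg (· * _) (hg.src_mul (edge e))
  · obtain rfl := hfin.mem_toFinset.1 he
    rw [mul_assoc]; exact congrArg (_ * ·) (hg.mul_rng (ghost e))
  · rw [mul_assoc, ← mul_assoc (gen K Γ (ghost e)), hg.ghost_mul_edge_ne e f hef, zero_mul,
      mul_zero]
  · obtain ⟨l, u, w, hl, rfl⟩ := eq_nf_of_mul_self hc h0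
    obtain rfl : v = u := by
      by_contra huv
      exact h0 (by rw [← hb, nf, ← mul_assoc, hg.vert_mul_pathVal_ne hl huv, zero_mul])
    cases l with
    | nil =>
      cases hl
      obtain ⟨e, rfl⟩ := hne
      refine ⟨e, hfin.mem_toFinset.2 rfl, fun h => ?_⟩
      apply (isGrading Γ K).vert_ne_zero (Γ.r e)
      have h1 : gen K Γ (ghost e) * gen K Γ (vert (Γ.s e)) = gen K Γ (ghost e) :=
        hg.mul_rng (ghost e)
      change _ * (gen K Γ (vert (Γ.s e)) * gen K Γ (vert (Γ.s e))) = 0 at h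
      rw [hg.vert_mul_self, mul_assoc, h1] at h
      rw [← hg.ghost_mul_edge, ← hmul, h, zero_mul, mul_zero]
    | cons e l =>
      refine ⟨e, hfin.mem_toFinset.2 hl.1, ?_⟩
      rwa [nf, pathVal, ← mul_assoc, ← mul_assoc, hmul]

open ContractedAlgebra

variable (F : Type*) [Field F]

theorem sum_edges_sub_mem (v : V) (hfin : {e | Γ.s e = v}.Finite)
    (hne : {e | Γ.s e = v}.Nonempty) :
    ∑ e ∈ hfin.toFinset, of F (gen K Γ (edge e) * gen K Γ (ghost e)) - of F (gen K Γ (vert v)) ∈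
      (Γ.cuntzKriegerIdeal F K).toSubmodule := by
  rcases Nat.lt_or_ge hfin.toFinset.card 2 with h | h
  · obtain ⟨e, he⟩ := hne
    have he' := hfin.mem_toFinset.2 he
    have h1 : hfin.toFinset = {e} :=
      Finset.eq_singleton_iff_unique_mem.2 ⟨he', fun f hf =>
        Finset.card_le_one.1 (Nat.le_of_lt_succ h) f hf e he'⟩
    obtain rfl : Γ.s e = v := he
    rw [h1, Finset.sum_singleton, (isFamily Γ K).vert_eq e fun f hf => by
      simpa [h1] using hfin.mem_toFinset.2 hf, sub_self]
    exact Submodule.zero_mem _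
  · exact AlgIdeal.subset_span _ ⟨v, hfin, h, rfl⟩

/-- To show `d q q* ∈ I` it suffices to show `d (q t) (q t)* ∈ I` for the continuations `t` of `q`
that have length `N` or reach a sink: modulo `I`, the idempotent `q q*` is the sum of the
`(q e) (q e)*` over the edges `e` emitted by the end of `q`. -/
theorem mul_nf_mem_of_forall_append (hΓ : Γ.RowFinite)
    (d : ContractedAlgebra F (Γ.LeavittInverseSemigroup K)) (N : ℕ) {v w : V} {q : List E}
    (hq : Γ.IsPath v q w)
    (h : ∀ t w', Γ.IsPath w t w' → (t.length = N ∨ ∀ e, Γ.s e ≠ w') →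
      d * of F (nf (gen K Γ) (q ++ t) (q ++ t) w') ∈ (Γ.cuntzKriegerIdeal F K).toSubmodule) :
    d * of F (nf (gen K Γ) q q w) ∈ (Γ.cuntzKriegerIdeal F K).toSubmodule := by
  have hg := isFamily Γ K
  induction N generalizing q w with
  | zero => simpa using h [] w rfl (.inl rfl)
  | succ N ih =>
    by_cases hw : ∃ e, Γ.s e = w
    swap
    · simpa using h [] w rfl (.inr (not_exists.1 hw))
    have hstep (e) (he : e ∈ (hΓ w).toFinset) :
        d * of F (nf (gen K Γ) (q ++ [e]) (q ++ [e]) (Γ.r e)) ∈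
          (Γ.cuntzKriegerIdeal F K).toSubmodule := by
      have he : Γ.s e = w := (hΓ w).mem_toFinset.1 he
      refine ih (hq.append (m := [e]) ⟨he, rfl⟩) fun t w' ht htN => ?_
      rw [List.append_assoc]
      refine h _ w' ⟨he, ht⟩ (htN.imp_left fun h => ?_)
      simp [h]
    have hnf (e) (he : e ∈ (hΓ w).toFinset) :
        of F (nf (gen K Γ) (q ++ [e]) (q ++ [e]) (Γ.r e)) = of F (pathVal (gen K Γ) q w) *
          of F (gen K Γ (edge e) * gen K Γ (ghost e)) * of F (ghostVal (gen K Γ) q w) := by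
      have he : Γ.IsPath w [e] (Γ.r e) := ⟨(hΓ w).mem_toFinset.1 he, rfl⟩
      rw [nf, hg.pathVal_append q he, hg.ghostVal_append q he, hg.pathVal_singleton,
        hg.ghostVal_singleton, ← of_mul, ← of_mul]
      simp only [mul_assoc]
    have hq' : of F (nf (gen K Γ) q q w) = of F (pathVal (gen K Γ) q w) *
        of F (gen K Γ (vert w)) * of F (ghostVal (gen K Γ) q w) := by
      rw [← of_mul, ← of_mul, hg.pathVal_mul_vert, nf]
    have key := (Γ.cuntzKriegerIdeal F K).mul_mem_left d
      ((Γ.cuntzKriegerIdeal F K).mul_mem_right (of F (ghostVal (gen K Γ) q w))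
        ((Γ.cuntzKriegerIdeal F K).mul_mem_left (of F (pathVal (gen K Γ) q w))
          (sum_edges_sub_mem F w (hΓ w) hw)))
    rw [mul_sub, sub_mul, ← hq', mul_sub, Finset.mul_sum, Finset.sum_mul,
      ← Finset.sum_congr rfl hnf, Finset.mul_sum] at key
    exact (Submodule.sub_mem_iff_right _ (Submodule.sum_mem _ hstep)).1 key

/-- The sum of an orthogonal cover of an idempotent `b` equals `b` modulo the Cuntz–Krieger ideal.
The cylinder of a path `t` that is long enough, or ends in a sink, lies inside the cylinder of one
member of the cover and is disjoint from those of the others, so the difference is annihilated by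
`t t*`. -/
theorem _root_.DirectedGraph.IsOrthogonalCover.sum_sub_mem (hΓ : Γ.RowFinite) {ι : Type*}
    {s : Finset ι} {a : ι → Γ.LeavittInverseSemigroup K} {b : Γ.LeavittInverseSemigroup K}
    (h : IsOrthogonalCover s a b) :
    ∑ i ∈ s, of F (a i) - of F b ∈ (Γ.cuntzKriegerIdeal F K).toSubmodule := by
  have hg := isFamily Γ K
  by_cases hb : b = 0
  · rw [Finset.sum_eq_zero, hb, of_zero, sub_self]
    · exact Submodule.zero_mem _
    · intro i hi
      rw [← h.base_mul i hi, hb, zero_mul, of_zero]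
  obtain ⟨q, v, w, hq, hbq⟩ := eq_nf_of_mul_self h.base_mul_self hb
  have hd : (∑ i ∈ s, of F (a i) - of F b) * of F b = ∑ i ∈ s, of F (a i) - of F b := by
    rw [sub_mul, Finset.sum_mul, ← of_mul, h.base_mul_self]
    congr 1
    exact Finset.sum_congr rfl fun i hi => by rw [← of_mul, h.mul_base i hi]
  have ha (i) : ∃ N : ℕ, i ∈ s → a i ≠ 0 →
      ∃ p u x, Γ.IsPath u p x ∧ a i = nf (gen K Γ) p p x ∧ p.length ≤ N := by
    by_cases hi : i ∈ s ∧ a i ≠ 0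
    · obtain ⟨p, u, x, hp, hpa⟩ := eq_nf_of_mul_self (h.mul_self i hi.1) hi.2
      exact ⟨p.length, fun _ _ => ⟨p, u, x, hp, hpa, le_rfl⟩⟩
    · exact ⟨0, fun h1 h2 => absurd ⟨h1, h2⟩ hi⟩
  choose N hN using ha
  rw [← hd, hbq]
  refine mul_nf_mem_of_forall_append F hΓ _ (s.sup N) hq fun t w' ht htN => ?_
  set c := nf (gen K Γ) (q ++ t) (q ++ t) w' with hc
  have hqt := hq.append ht
  have hcc : c * c = c := hg.nf_self_mul_self hqt
  have hbc : b * c = c := by rw [hbq]; exact hg.nf_self_mul_nf_self hq ht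
  have hc0 : c ≠ 0 := hg.nf_ne_zero (isGrading Γ K) hqt hqt
  obtain ⟨i, hi, hne⟩ := h.exists_mul_ne_zero c hcc hbc hc0
  obtain ⟨p, u, x, hp, hpa, hpN⟩ := hN i hi fun h0 => hne (by rw [h0, zero_mul])
  have hpN' : p.length ≤ s.sup N := hpN.trans (Finset.le_sup hi)
  have hic : a i * c = c := by
    rw [hpa] at hne ⊢
    rcases hg.comparable_of_nf_mul_nf_ne_zero hp hqt hne with ⟨r, hr, hr'⟩ | ⟨r, hr, hr'⟩
    · rw [hc, hr]
      exact hg.nf_self_mul_nf_self hp hr'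
    · -- `p` cannot extend `q t` properly: either `p` would be too long, or `q t` ends in a sink.
      cases r with
      | nil =>
        cases hr'
        rw [List.append_nil] at hr
        rw [hr]
        exact hcc
      | cons e r =>
        exfalso
        rcases htN with h1 | h1
        · rw [hr] at hpN'
          simp only [List.length_append, List.length_cons] at hpN'
          omega
        · exact h1 e hr'.1
  rw [← hbq, sub_mul, Finset.sum_mul, ← of_mul, hbc, Finset.sum_eq_single i, ← of_mul, hic,
    sub_self]
  · exact Submodule.zero_mem _
  · intro j hj hji
    rw [← of_mul, ← hic, ← mul_assoc, h.orthogonal j hj i hi hji, zero_mul, of_zero]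
  · exact fun h => absurd hi h

/-! ### Transport along an isomorphism -/

variable {V' E' : Type*} {Δ : DirectedGraph V' E'}

theorem _root_.ContractedAlgebra.exists_map {S T : Type*} [SemigroupWithZero S]
    [SemigroupWithZero T] (φ : S ≃* T) :
    ∃ η : ContractedAlgebra F S →ₙₐ[F] ContractedAlgebra F T, ∀ x, η (of F x) = of F (φ x) :=
  ⟨ContractedAlgebra.lift ⟨fun x => of F (φ x), fun x y => by rw [map_mul, of_mul]⟩
    (by change of F (φ 0) = 0; rw [map_zero, of_zero]), fun x => ContractedAlgebra.lift_of _ _ x⟩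

/-- Isomorphisms preserve orthogonal covers, hence the Cuntz–Krieger ideals. -/
theorem map_mem_cuntzKriegerIdeal (hΔ : Δ.RowFinite)
    (φ : Γ.LeavittInverseSemigroup K ≃* Δ.LeavittInverseSemigroup K)
    {η : ContractedAlgebra F (Γ.LeavittInverseSemigroup K) →ₙₐ[F]
      ContractedAlgebra F (Δ.LeavittInverseSemigroup K)}
    (hη : ∀ x, η (of F x) = of F (φ x))
    {a : ContractedAlgebra F (Γ.LeavittInverseSemigroup K)}
    (ha : a ∈ (Γ.cuntzKriegerIdeal F K).toSubmodule) :
    η a ∈ (Δ.cuntzKriegerIdeal F K).toSubmodule := by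
  refine AlgIdeal.span_le (J := AlgIdeal.comap η (Δ.cuntzKriegerIdeal F K)) ?_ ha
  rintro _ ⟨v, hfin, h2, rfl⟩
  have hne : {e | Γ.s e = v}.Nonempty := by
    obtain ⟨e, he⟩ := Finset.card_pos.1 (zero_lt_two.trans_le h2)
    exact ⟨e, hfin.mem_toFinset.1 he⟩
  refine AlgIdeal.mem_comap.2 ?_
  simp only [map_sub, map_sum, hη]
  exact ((isOrthogonalCover_edges v hfin hne).map φ).sum_sub_mem F hΔ

theorem lift_toLeavitt_eq_zero {a : ContractedAlgebra F (Γ.LeavittInverseSemigroup K)}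
    (ha : a ∈ (Γ.cuntzKriegerIdeal F K).toSubmodule) :
    ContractedAlgebra.lift (F := F) (toLeavitt Γ K F) (toLeavitt_zero F) a = 0 := by
  refine AlgIdeal.span_le (J := AlgIdeal.comap
    (ContractedAlgebra.lift (F := F) (toLeavitt Γ K F) (toLeavitt_zero F))
    (AlgIdeal.bot F (Γ.LeavittPathAlgebra F))) ?_ ha
  rintro _ ⟨v, hfin, h2, rfl⟩
  have hne : {e | Γ.s e = v}.Nonempty := by
    obtain ⟨e, he⟩ := Finset.card_pos.1 (zero_lt_two.trans_le h2)
    exact ⟨e, hfin.mem_toFinset.1 he⟩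
  change ContractedAlgebra.lift (F := F) (toLeavitt Γ K F) (toLeavitt_zero F) _ = 0
  simp only [map_sub, map_sum, ContractedAlgebra.lift_of, map_mul, toLeavitt_gen]
  rw [LeavittPathAlgebra.gen_vert_eq_sum Γ F v hfin hne, sub_self]

/-- An isomorphism of Leavitt inverse semigroups over `K` induces a homomorphism of Leavitt path
algebras over `F`. The Cuntz–Krieger relation at `v` is respected because the images of the
`e e*` form an orthogonal cover of the image of `v`. -/
theorem exists_leavitt_map (hΔ : Δ.RowFinite)
    (φ : Γ.LeavittInverseSemigroup K ≃* Δ.LeavittInverseSemigroup K) :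
    ∃ θ : Γ.LeavittPathAlgebra F →ₙₐ[F] Δ.LeavittPathAlgebra F,
      ∀ x, θ (toLeavitt Γ K F x) = toLeavitt Δ K F (φ x) := by
  have hg := isFamily Γ K
  let f : Γ.LeavittInverseSemigroup K →ₙ* Δ.LeavittPathAlgebra F :=
    (toLeavitt Δ K F).comp (φ : Γ.LeavittInverseSemigroup K →ₙ* Δ.LeavittInverseSemigroup K)
  have hf (x) : f x = toLeavitt Δ K F (φ x) := rfl
  have f0 : f 0 = 0 := by rw [hf, map_zero, toLeavitt_zero]
  have hfam : Γ.IsFamily fun x => f (gen K Γ x) :=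
    ⟨fun x => by rw [← map_mul, hg.src_mul], fun x => by rw [← map_mul, hg.mul_rng],
      fun u v h => by rw [← map_mul, hg.vert_mul_vert u v h, f0],
      fun e e' h => by rw [← map_mul, hg.ghost_mul_edge_ne e e' h, f0],
      fun e => by rw [← map_mul, hg.ghost_mul_edge],
      fun e h => by rw [← map_mul, hg.vert_eq e h]⟩
  have hck (v : V) (hfin : {e | Γ.s e = v}.Finite) (hne : {e | Γ.s e = v}.Nonempty) :
      f (gen K Γ (vert v)) = ∑ e ∈ hfin.toFinset, f (gen K Γ (edge e)) * f (gen K Γ (ghost e)) := by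
    have := lift_toLeavitt_eq_zero F
      (((isOrthogonalCover_edges (K := K) v hfin hne).map φ).sum_sub_mem F hΔ)
    simp only [map_sub, map_sum, ContractedAlgebra.lift_of] at this
    exact (sub_eq_zero.1 this).symm.trans
      (Finset.sum_congr rfl fun e _ => by rw [← map_mul]; rfl)
  let θ : Γ.LeavittPathAlgebra F →ₙₐ[F] Δ.LeavittPathAlgebra F := LeavittPathAlgebra.lift _ hfam hck
  have hθ : (θ : Γ.LeavittPathAlgebra F →ₙ* Δ.LeavittPathAlgebra F).comp (toLeavitt Γ K F) = f := by
    refine hom_ext ?_ fun x => ?_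
    · change θ (toLeavitt Γ K F 0) = _
      rw [toLeavitt_zero, map_zero, f0]
    · change θ (toLeavitt Γ K F (gen K Γ x)) = _
      rw [toLeavitt_gen, LeavittPathAlgebra.lift_gen]
  exact ⟨θ, DFunLike.congr_fun hθ⟩

end LeavittInverseSemigroup

end DirectedGraph

end

theorem mainTheorem2 {V₁ E₁ V₂ E₂ : Type*}
    (Γ : DirectedGraph V₁ E₁) (Δ : DirectedGraph V₂ E₂)
    (hΓ : Γ.RowFinite) (hΔ : Δ.RowFinite) (hΓc : Γ.Connected) (hΔc : Δ.Connected)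
    (K : Type*) [Field K]
    (φ : Γ.LeavittInverseSemigroup K ≃* Δ.LeavittInverseSemigroup K)
    (F : Type*) [Field F] :
    (∃ θ : Γ.LeavittPathAlgebra F →ₙₐ[F] Δ.LeavittPathAlgebra F, Function.Bijective θ) ∧
    ∃ η : ContractedAlgebra F (Γ.LeavittInverseSemigroup K) →ₙₐ[F]
        ContractedAlgebra F (Δ.LeavittInverseSemigroup K),
      Function.Bijective η ∧
      (∀ x, η (ContractedAlgebra.of F x) = ContractedAlgebra.of F (φ x)) ∧
      η '' ((Γ.cuntzKriegerIdeal F K).toSubmodule : Set _) =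
        ((Δ.cuntzKriegerIdeal F K).toSubmodule : Set _) := by
  open DirectedGraph LeavittInverseSemigroup in
  constructor
  · obtain ⟨θ, hθ⟩ := exists_leavitt_map F hΔ φ
    obtain ⟨θ', hθ'⟩ := exists_leavitt_map F hΓ φ.symm
    have h1 : θ'.comp θ = NonUnitalAlgHom.id F _ := LeavittPathAlgebra.hom_ext fun x => by
      rw [NonUnitalAlgHom.comp_apply, ← toLeavitt_gen (K := K), hθ, hθ', φ.symm_apply_apply]; rfl
    have h2 : θ.comp θ' = NonUnitalAlgHom.id F _ := LeavittPathAlgebra.hom_ext fun x => by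
      rw [NonUnitalAlgHom.comp_apply, ← toLeavitt_gen (K := K), hθ', hθ, φ.apply_symm_apply]; rfl
    exact ⟨θ, Function.bijective_iff_has_inverse.2
      ⟨θ', DFunLike.congr_fun h1, DFunLike.congr_fun h2⟩⟩
  · obtain ⟨η, hη⟩ := ContractedAlgebra.exists_map F φ
    obtain ⟨η', hη'⟩ := ContractedAlgebra.exists_map F φ.symm
    have h1 : η'.comp η = NonUnitalAlgHom.id F _ := ContractedAlgebra.hom_ext fun x => by
      rw [NonUnitalAlgHom.comp_apply, hη, hη', φ.symm_apply_apply]; rfl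
    have h2 : η.comp η' = NonUnitalAlgHom.id F _ := ContractedAlgebra.hom_ext fun x => by
      rw [NonUnitalAlgHom.comp_apply, hη', hη, φ.apply_symm_apply]; rfl
    refine ⟨η, Function.bijective_iff_has_inverse.2
      ⟨η', DFunLike.congr_fun h1, DFunLike.congr_fun h2⟩, hη, Set.Subset.antisymm ?_ ?_⟩
    · rintro _ ⟨a, ha, rfl⟩
      exact map_mem_cuntzKriegerIdeal F hΔ φ hη ha
    · exact fun b hb =>
        ⟨η' b, map_mem_cuntzKriegerIdeal F hΓ φ.symm hη' hb, DFunLike.congr_fun h2 b⟩
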